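/- Let $\mathcal H$ be a complex Hilbert space and let $\mathcal P(\mathcal H)$ be the set of orthogonal projections in $\mathcal B(\mathcal H)$. A smooth curve $\gamma:[0,1]\to\mathcal P(\mathcal H)$ is a geodesic (for the Porta--Recht connection) if the tangential part of its second derivative vanishes, i.e. $\gamma\,\ddot\gamma\,(1-\gamma)+(1-\gamma)\,\ddot\gamma\,\gamma=0$ on $[0,1]$. A geodesic is minimal if its length $\int_0^1\|\dot\gamma(t)\|\,dt$ (operator norm) is not larger than the length of any piecewise smooth curve in $\mathcal P(\mathcal H)$ with the same end points. Let $E\in\mathcal B(\mathcal H)$ be an idempotent, $E^2=E$. Write $E=\begin{pmatrix}1&B\\0&0\end{pmatrix}$ with respect to $\mathcal H=R(E)\oplus R(E)^\perp$, put $T=(1+BB^*)^{1/2}$ on $R(E)$, and let $$m(E)=\frac12\begin{pmatrix}(T+1)T^{-1}&T^{-1}B\\B^*T^{-1}&B^*\big(T(T+1)\big)^{-1}B\end{pmatrix}$$ be the matched projection of $E$. Denote by $P_{R(E)}$ and $P_{R(E^*)}$ the orthogonal projections onto the ranges of $E$ and $E^*$. Theorem. There is a unique minimal geodesic $\gamma_E:[0,1]\to\mathcal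 P(\mathcal H)$ such that $\gamma_E(0)=P_{R(E)}$ and $\gamma_E(1)=P_{R(E^*)}$, and $$m(E)=\gamma_E\left(\tfrac12\right).$$ -/

import Mathlib

open scoped ContDiff

namespace MatchedProj

noncomputable section

variable {H : Type*} [NormedAddCommGroup H] [InnerProductSpace ℂ H]

/-- The range `R(E)` as a closed subspace. The closure is taken only so that the orthogonal
projection makes sense for every bounded operator; see `closedRange_eq_range`. -/
abbrev closedRange (E : H →L[ℂ] H) : Submodule ℂ H :=
  (LinearMap.range (E : H →ₗ[ℂ] H)).topologicalClosure

/-- For an idempotent the range is already closed, so `closedRange E` is `R(E)` itself. -/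
theorem closedRange_eq_range (E : H →L[ℂ] H) (hE : IsIdempotentElem E) :
    closedRange E = LinearMap.range (E : H →ₗ[ℂ] H) :=
  IsClosed.submodule_topologicalClosure_eq
    (ContinuousLinearMap.IsIdempotentElem.isClosed_range hE)

variable [CompleteSpace H]

/-- The orthogonal projection `P_{R(E)}`, as an operator on `H`. -/
def rangeProj (E : H →L[ℂ] H) : H →L[ℂ] H := (closedRange E).starProjection

/-! ### The matched projection -/

/-- The `(1,2)` block `B : R(E)ᗮ → R(E)` of `E` in `H = R(E) ⊕ R(E)ᗮ`. -/
def blockB (E : H →L[ℂ] H) : (closedRange E)ᗮ →L[ℂ] closedRange E :=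
  (closedRange E).orthogonalProjectionOnto ∘L E ∘L (closedRange E)ᗮ.subtypeL

section Blocks

variable {K L : Type*} [NormedAddCommGroup K] [InnerProductSpace ℂ K] [CompleteSpace K]
  [NormedAddCommGroup L] [InnerProductSpace ℂ L] [CompleteSpace L]

/-- The operator `T = (1 + B B*)^{1/2}` on `K`, for `B : L → K`. -/
def opT (B : L →L[ℂ] K) : K →L[ℂ] K :=
  CFC.sqrt (1 + B ∘L ContinuousLinearMap.adjoint B)

/-- The block `(T+1)T⁻¹`. All inverses here and below are genuine inverses, as `T ≥ 1`. -/
def block11 (B : L →L[ℂ] K) : K →L[ℂ] K := (opT B + 1) * Ring.inverse (opT B)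

/-- The block `T⁻¹B`. -/
def block12 (B : L →L[ℂ] K) : L →L[ℂ] K := Ring.inverse (opT B) ∘L B

/-- The block `B*T⁻¹`. -/
def block21 (B : L →L[ℂ] K) : K →L[ℂ] L :=
  ContinuousLinearMap.adjoint B ∘L Ring.inverse (opT B)

/-- The block `B*(T(T+1))⁻¹B`. -/
def block22 (B : L →L[ℂ] K) : L →L[ℂ] L :=
  ContinuousLinearMap.adjoint B ∘L Ring.inverse (opT B * (opT B + 1)) ∘L B

end Blocks

/-- The operator on `H` whose block matrix with respect to `H = S ⊕ Sᗮ` is `(a b; c d)`. -/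
def ofBlocks (S : Submodule ℂ H) [S.HasOrthogonalProjection]
    (a : S →L[ℂ] S) (b : Sᗮ →L[ℂ] S) (c : S →L[ℂ] Sᗮ) (d : Sᗮ →L[ℂ] Sᗮ) : H →L[ℂ] H :=
  S.subtypeL ∘L (a ∘L S.orthogonalProjectionOnto + b ∘L Sᗮ.orthogonalProjectionOnto) +
    Sᗮ.subtypeL ∘L (c ∘L S.orthogonalProjectionOnto + d ∘L Sᗮ.orthogonalProjectionOnto)

/-- The matched projection `m(E)` of an idempotent `E`: with respect to `R(E) ⊕ R(E)ᗮ`,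
`m(E) = ½ ( (T+1)T⁻¹  T⁻¹B ; B*T⁻¹  B*(T(T+1))⁻¹B )` with `T = (1 + B B*)^{1/2}`. -/
def matched (E : H →L[ℂ] H) : H →L[ℂ] H :=
  (1 / 2 : ℂ) • ofBlocks (closedRange E) (block11 (blockB E)) (block12 (blockB E))
    (block21 (blockB E)) (block22 (blockB E))

/-! ### Curves in the Grassmann manifold of orthogonal projections -/

/-- The co-diagonal part of `A` with respect to the orthogonal projection `P`. On self-adjoint
operators this is the natural projection onto the tangent space at `P` of the manifold of
orthogonal projections, i.e. onto the self-adjoint `P`-co-diagonal operators. -/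
def codiag (P A : H →L[ℂ] H) : H →L[ℂ] H := P * A * (1 - P) + (1 - P) * A * P

/-- The covariant derivative, for the Porta–Recht connection, of a field `X` along a curve `γ` of
orthogonal projections parametrized in `[0,1]`: the tangential part of the derivative. -/
def covDeriv (γ X : ℝ → H →L[ℂ] H) (t : ℝ) : H →L[ℂ] H :=
  codiag (γ t) (derivWithin X (Set.Icc 0 1) t)

/-- `γ`, on `[0,1]`, is a geodesic of the manifold of orthogonal projections: a smooth curve of
orthogonal projections whose velocity field is parallel along it. -/
structure IsGeodesic (γ : ℝ → H →L[ℂ] H) : Prop where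
  smooth : ContDiffOn ℝ ∞ γ (Set.Icc 0 1)
  isProj : ∀ t ∈ Set.Icc (0 : ℝ) 1, IsStarProjection (γ t)
  parallel : ∀ t ∈ Set.Icc (0 : ℝ) 1, covDeriv γ (derivWithin γ (Set.Icc 0 1)) t = 0

/-- `c`, on `[0,1]`, is a piecewise smooth curve of orthogonal projections. (Smoothness on closed
pieces with common end points includes continuity.) -/
structure IsPiecewiseSmoothCurve (c : ℝ → H →L[ℂ] H) : Prop where
  isProj : ∀ t ∈ Set.Icc (0 : ℝ) 1, IsStarProjection (c t)
  pieces : ∃ (n : ℕ) (τ : ℕ → ℝ), Monotone τ ∧ τ 0 = 0 ∧ τ n = 1 ∧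
    ∀ i < n, ContDiffOn ℝ ∞ c (Set.Icc (τ i) (τ (i + 1)))

/-- The length on `[0,1]` for the Finsler metric given by the operator norm. -/
def length (c : ℝ → H →L[ℂ] H) : ℝ := ∫ t in (0 : ℝ)..1, ‖deriv c t‖

/-- `γ`, on `[0,1]`, is a minimal geodesic from `P` to `Q`: a geodesic with these end points which
is not longer than any piecewise smooth curve of orthogonal projections from `P` to `Q`. -/
structure IsMinimalGeodesic (γ : ℝ → H →L[ℂ] H) (P Q : H →L[ℂ] H) : Prop where
  geodesic : IsGeodesic γ
  source : γ 0 = P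
  target : γ 1 = Q
  minimal : ∀ c : ℝ → H →L[ℂ] H, IsPiecewiseSmoothCurve c → c 0 = P → c 1 = Q →
    length γ ≤ length c

end

end MatchedProj

namespace MatchedProj

/-! Put `P = P_{R(E)}`, `Q = P_{R(E*)}`, `S = 2P - 1` and `G = E + E* - 1`. In blocks `G = (1 B; B*
-1)`, so `G - S` anticommutes with `S` and `G² = 1 + (G - S)² ≥ 1`. Moreover `GP = QG`. With `N =
|G|` and `J = N⁻¹`, the polar part `V = JG` is a symmetry with `V S V = 2Q - 1`, and the block
formula for the matched projection collapses to `½(1 + V)` (`matched_eq`).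

Since `VS + SV = 2J` with `0 < J ≤ 1`, one gets `‖VS - 1‖² = 2‖1 - J‖ < 2`. Hence `VS = exp X` with
`X` skew-adjoint, anticommuting with `S`, and `‖X‖ < π/2` (`exists_log_mul_symmetry`). For `Y = 2X`
the curve `½(1 + exp(tY) S)` is a geodesic of length `‖Y‖/2` from `P` to `Q`, with midpoint `½(1 +
V)`.

Minimality: along a curve of projections `c` the angle `arccos Re⟪ξ, (2c - 1)ξ⟫` of a unit vector
changes by at most twice the length, whence `‖P - Q‖ ≤ sin (length c)` when `length c ≤ π/2`
(`IsPiecewiseSmoothCurve.norm_sub_le_sin`). The exponential curve attains equality, because `2‖P -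
Q‖ = ‖exp Y - 1‖ = 2 sin(‖Y‖/2)`.

Uniqueness: any geodesic from `P` is such a curve for some `Z` (`IsGeodesic.exists_eqOn_expCurve`).
Minimality forces `‖Z‖ ≤ ‖Y‖ < π`, and logarithms of norm below `π` are unique. -/

theorem commute_of_mul_eq_one {M : Type*} [Monoid M] {J N X : M} (h1 : J * N = 1) (h2 : N * J = 1)
    (hX : Commute N X) : Commute J X := by
  have : N * X = X * N := hX
  rw [Commute, SemiconjBy]
  calc J * X = J * (X * N) * J := by rw [mul_assoc, mul_assoc, h2, mul_one]
    _ = X * J := by rw [← this, ← mul_assoc, h1, one_mul]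

/-! ### The polar decomposition of `E + E* - 1`, in a C*-algebra. -/

section Polar

variable {A : Type*} [CStarAlgebra A]

theorem norm_one_sub_lt_one [PartialOrder A] [StarOrderedRing A] {J : A}
    (hJ : IsStrictlyPositive J) (hJ1 : J ≤ 1) : ‖1 - J‖ < 1 := by
  nontriviality A
  have hsa : IsSelfAdjoint J := hJ.1.isSelfAdjoint
  -- A strictly positive element has a scalar lower bound `r > 0`; taking `min r 1` keeps the bound
  -- `1 - min r 1` nonnegative, as the norm criterion needs.
  obtain ⟨r, hr, hrJ⟩ := (CFC.exists_pos_algebraMap_le_iff hsa).2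
    (fun x hx => hJ.spectrum_pos hx)
  have hle : 1 - J ≤ algebraMap ℝ A (1 - min r 1) := by
    rw [map_sub, map_one]
    exact sub_le_sub_left ((algebraMap_mono A (min_le_left r 1)).trans hrJ) 1
  have h := (CStarAlgebra.norm_le_iff_le_algebraMap (1 - J) (sub_nonneg.2 (min_le_right r 1))
    (sub_nonneg.2 hJ1)).2 hle
  have : 0 < min r 1 := lt_min hr one_pos
  linarith

/-- The element `E + E* - 1`. -/
def symPart (E : A) : A := E + star E - 1

theorem isSelfAdjoint_symPart (E : A) : IsSelfAdjoint (symPart E) := by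
  simp [IsSelfAdjoint, symPart, add_comm]

/-- `P` and `Q` are the orthogonal projections onto the ranges of `E` and `E*`. -/
structure IsRangePair (E P Q : A) : Prop where
  left : IsStarProjection P
  right : IsStarProjection Q
  left_mul : P * E = E
  mul_left : E * P = P
  right_mul : Q * star E = star E
  mul_right : star E * Q = Q

/-- The positive square root of `(E + E* - 1)²`. -/
noncomputable def absPart [PartialOrder A] [StarOrderedRing A] (E : A) : A :=
  CFC.sqrt (symPart E * symPart E)

namespace IsRangePair

variable {E P Q : A}

theorem star_left_mul (h : IsRangePair E P Q) : star E * P = star E := by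
  simpa [h.left.2.star_eq] using congrArg star h.left_mul

theorem star_mul_left (h : IsRangePair E P Q) : P * star E = P := by
  simpa [h.left.2.star_eq] using congrArg star h.mul_left

theorem star_right_mul (h : IsRangePair E P Q) : E * Q = E := by
  simpa [h.right.2.star_eq] using congrArg star h.right_mul

theorem star_mul_right (h : IsRangePair E P Q) : Q * E = Q := by
  simpa [h.right.2.star_eq] using congrArg star h.mul_right

theorem symPart_mul_left (h : IsRangePair E P Q) : symPart E * P = Q * symPart E := by
  have h1 := h.star_left_mul
  have h2 := h.mul_left
  have h3 := h.right_mul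
  have h4 := h.star_mul_right
  simp only [symPart, mul_add, add_mul, mul_sub, sub_mul, mul_one, one_mul, h1, h2, h3, h4]
  abel_nf

theorem left_mul_symPart (h : IsRangePair E P Q) : P * symPart E = symPart E * Q := by
  have h1 := h.left_mul
  have h2 := h.star_mul_left
  have h3 := h.star_right_mul
  have h4 := h.mul_right
  simp only [symPart, mul_add, add_mul, mul_sub, sub_mul, mul_one, one_mul, h1, h2, h3, h4]
  abel_nf

/-- `G - S` is off-diagonal with respect to `P`, so it anticommutes with `S`, and only `2S² = 2`
survives. -/
theorem symPart_anticomm (h : IsRangePair E P Q) :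
    symPart E * (2 * P - 1) + (2 * P - 1) * symPart E = 2 := by
  have h1 := h.star_left_mul
  have h2 := h.mul_left
  have h3 := h.left_mul
  have h4 := h.star_mul_left
  rw [← one_add_one_eq_two]
  simp only [symPart, mul_add, add_mul, mul_sub, sub_mul, mul_one, one_mul, h1, h2, h3, h4]
  abel_nf

theorem symPart_mul_self (h : IsRangePair E P Q) :
    symPart E * symPart E = 1 + star (symPart E - (2 * P - 1)) * (symPart E - (2 * P - 1)) := by
  have hs : star (symPart E - (2 * P - 1)) = symPart E - (2 * P - 1) := by
    simp [symPart, h.left.2.star_eq, two_mul, add_comm]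
  have h1 := h.symPart_anticomm
  have h2 : P * P = P := h.left.1
  have h3 : (symPart E - (2 * P - 1)) * (symPart E - (2 * P - 1)) =
      symPart E * symPart E - (symPart E * (2 * P - 1) + (2 * P - 1) * symPart E)
        + (4 * (P * P) - 4 * P + 1) := by noncomm_ring
  rw [hs, h3, h1, h2, ← one_add_one_eq_two]
  noncomm_ring

theorem commute_left_sq (h : IsRangePair E P Q) : Commute (symPart E * symPart E) P := by
  have h1 := h.symPart_mul_left
  have h2 := h.left_mul_symPart
  rw [Commute, SemiconjBy, mul_assoc, h1, ← mul_assoc, ← h2, mul_assoc]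

theorem commute_right_sq (h : IsRangePair E P Q) : Commute (symPart E * symPart E) Q := by
  have h1 := h.symPart_mul_left
  have h2 := h.left_mul_symPart
  rw [Commute, SemiconjBy, mul_assoc, ← h2, ← mul_assoc, h1, mul_assoc]

variable [PartialOrder A] [StarOrderedRing A]

theorem one_le_symPart_sq (h : IsRangePair E P Q) : 1 ≤ symPart E * symPart E := by
  rw [h.symPart_mul_self]
  exact le_add_of_nonneg_right (star_mul_self_nonneg _)

theorem symPart_sq_nonneg (h : IsRangePair E P Q) : 0 ≤ symPart E * symPart E :=
  zero_le_one.trans h.one_le_symPart_sq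

theorem absPart_mul_self (h : IsRangePair E P Q) :
    absPart E * absPart E = symPart E * symPart E :=
  CFC.sqrt_mul_sqrt_self _ h.symPart_sq_nonneg

theorem one_le_absPart (h : IsRangePair E P Q) : 1 ≤ absPart E := by
  simpa [absPart] using CFC.sqrt_le_sqrt _ _ h.one_le_symPart_sq

theorem absPart_pos (h : IsRangePair E P Q) : IsStrictlyPositive (absPart E) :=
  isStrictlyPositive_one.of_le h.one_le_absPart

theorem commute_absPart {X : A} (hX : Commute (symPart E * symPart E) X) :
    Commute (absPart E) X := hX.cfcₙ_nnreal _

/-- The inverse of `absPart E` exists and has the expected properties. -/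
theorem exists_inverse (h : IsRangePair E P Q) :
    ∃ J : A, J * absPart E = 1 ∧ absPart E * J = 1 ∧ IsStrictlyPositive J ∧ J ≤ 1 := by
  have hu := h.absPart_pos.isUnit
  refine ⟨Ring.inverse (absPart E), Ring.inverse_mul_cancel _ hu, Ring.mul_inverse_cancel _ hu,
    h.absPart_pos.ringInverse, ?_⟩
  simpa using CStarAlgebra.ringInverse_le_ringInverse h.one_le_absPart isStrictlyPositive_one

/-- The symmetry in the polar decomposition of `E + E* - 1` exchanges the two projections, and its
product with `2P - 1` has positive real part. -/
theorem exists_symmetry (h : IsRangePair E P Q) {J : A} (h1 : J * absPart E = 1)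
    (h2 : absPart E * J = 1) (hJ : IsStrictlyPositive J) (hJ1 : J ≤ 1) {V : A}
    (hV : V = J * symPart E) :
    IsSelfAdjoint V ∧ V * V = 1 ∧ V * (2 * P - 1) * V = 2 * Q - 1 ∧
      ‖V * (2 * P - 1) - 1‖ ^ 2 < 2 := by
  have hP2 : P * P = P := h.left.1
  have hS2 : (2 * P - 1) * (2 * P - 1) = 1 := by
    have : (2 * P - 1) * (2 * P - 1) = 4 * (P * P) - 4 * P + 1 := by noncomm_ring
    rw [this, hP2]; noncomm_ring
  have hJG : J * symPart E = symPart E * J := commute_of_mul_eq_one h1 h2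
    (commute_absPart ((Commute.refl (symPart E)).mul_left (Commute.refl _)))
  have hJP : J * P = P * J := commute_of_mul_eq_one h1 h2 (commute_absPart h.commute_left_sq)
  have hJQ : J * Q = Q * J := commute_of_mul_eq_one h1 h2 (commute_absPart h.commute_right_sq)
  have hJs : star J = J := hJ.1.isSelfAdjoint
  have hJGG : J * J * (symPart E * symPart E) = 1 := by
    rw [← h.absPart_mul_self, mul_assoc, ← mul_assoc J (absPart E), h1, one_mul, h1]
  have hGs : star (symPart E) = symPart E := isSelfAdjoint_symPart E
  have hV1 : star V = V := by rw [hV, star_mul, hJs, hGs, hJG]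
  have hV2 : V * V = 1 := by
    rw [hV, mul_assoc, ← mul_assoc _ J, ← hJG, mul_assoc, ← mul_assoc, hJGG]
  have hVP : V * P = Q * V := by
    rw [hV, mul_assoc, h.symPart_mul_left, ← mul_assoc, hJQ, mul_assoc]
  have hVS : V * (2 * P - 1) = (2 * Q - 1) * V := by
    rw [mul_sub, sub_mul, two_mul, mul_add, hVP, two_mul, add_mul, mul_one, one_mul]
  refine ⟨hV1, hV2, by rw [hVS, mul_assoc, hV2, mul_one], ?_⟩
  have hSs : star (2 * P - 1) = 2 * P - 1 := by simp [two_mul, h.left.2.star_eq]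
  have hSJ : (2 * P - 1) * J = J * (2 * P - 1) := by
    rw [mul_sub, sub_mul, two_mul, mul_add, add_mul, hJP, mul_one, one_mul]
  have hsum : V * (2 * P - 1) + (2 * P - 1) * V = 2 * J := by
    rw [hV, ← mul_assoc, hSJ, mul_assoc, mul_assoc, ← mul_add, h.symPart_anticomm, mul_two, two_mul]
  -- `VS` is unitary, so `(VS - 1)*(VS - 1) = 2 - (VS + SV)`.
  have hkey : star (V * (2 * P - 1) - 1) * (V * (2 * P - 1) - 1) = (2 : ℝ) • (1 - J) := by
    rw [star_sub, star_mul, star_one, hSs, hV1, two_smul]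
    have : ((2 * P - 1) * V - 1) * (V * (2 * P - 1) - 1) =
      (2 * P - 1) * (V * V) * (2 * P - 1) - (V * (2 * P - 1) + (2 * P - 1) * V) + 1 := by
      noncomm_ring
    rw [this, hV2, mul_one, hS2, hsum]
    noncomm_ring
  rw [sq, ← CStarRing.norm_star_mul_self, hkey, norm_smul]
  have := norm_one_sub_lt_one hJ hJ1
  simp only [Real.norm_ofNat]
  linarith


end IsRangePair
end Polar

/-! ### The block formula of the matched projection, rewritten in the ambient algebra. -/

section Range

variable {H : Type*} [NormedAddCommGroup H] [InnerProductSpace ℂ H] [CompleteSpace H]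

theorem rangeProj_mul (E : H →L[ℂ] H) : rangeProj E * E = E := by
  ext x
  exact Submodule.starProjection_eq_self_iff.2
    (Submodule.le_topologicalClosure _ (LinearMap.mem_range_self (E : H →ₗ[ℂ] H) x))

theorem mul_rangeProj {E : H →L[ℂ] H} (hE : IsIdempotentElem E) :
    E * rangeProj E = rangeProj E := by
  ext x
  have hx : rangeProj E x ∈ LinearMap.range (E : H →ₗ[ℂ] H) := by
    rw [← closedRange_eq_range E hE]
    exact Submodule.starProjection_apply_mem _ x
  obtain ⟨y, hy⟩ := hx
  have hy' : E y = rangeProj E x := hy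
  change E (rangeProj E x) = _
  rw [← hy']
  exact congrArg (fun F : H →L[ℂ] H => F y) hE.eq

theorem isRangePair {E : H →L[ℂ] H} (hE : IsIdempotentElem E) :
    IsRangePair E (rangeProj E) (rangeProj (ContinuousLinearMap.adjoint E)) where
  left := isStarProjection_starProjection
  right := isStarProjection_starProjection
  left_mul := rangeProj_mul E
  mul_left := mul_rangeProj hE
  right_mul := rangeProj_mul _
  mul_right := mul_rangeProj hE.star

/-- The compression of an operator to a closed subspace. -/
noncomputable def compress {H : Type*} [NormedAddCommGroup H] [InnerProductSpace ℂ H]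
    (K : Submodule ℂ H) [K.HasOrthogonalProjection] (X : H →L[ℂ] H) :
    K →L[ℂ] K :=
  K.orthogonalProjectionOnto ∘L X ∘L K.subtypeL

section Compress

variable {H : Type*} [NormedAddCommGroup H] [InnerProductSpace ℂ H]
  (K : Submodule ℂ H) [K.HasOrthogonalProjection] (X Y : H →L[ℂ] H)

theorem compress_one : compress K 1 = 1 := by
  ext x
  simp [compress]

theorem compress_mul (hX : X * K.starProjection = K.starProjection * X) :
    compress K X * compress K Y = compress K (X * Y) := by
  have h : compress K X * compress K Y = compress K (X * K.starProjection * Y) := rfl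
  rw [h, hX, mul_assoc]
  ext x
  exact congrArg Subtype.val
    (Submodule.orthogonalProjectionOnto_starProjection_of_le (le_refl K) ((X * Y) x))

theorem compress_add : compress K (X + Y) = compress K X + compress K Y := by
  ext x
  simp [compress]

theorem compress_nonneg (hX : 0 ≤ X) : 0 ≤ compress K X := by
  rw [ContinuousLinearMap.nonneg_iff_isPositive] at hX ⊢
  exact hX.orthogonalProjectionOnto_comp K

end Compress

theorem compress_conj_starProjection {H : Type*} [NormedAddCommGroup H] [InnerProductSpace ℂ H]
    (K : Submodule ℂ H) [K.HasOrthogonalProjection] (X : H →L[ℂ] H) :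
    compress K (K.starProjection * X * K.starProjection) = compress K X := by
  ext x
  have h : K.starProjection (x : H) = x := Submodule.starProjection_eq_self_iff.2 x.2
  have h' := Submodule.orthogonalProjectionOnto_starProjection_of_le (le_refl K) (X x)
  change ((K.orthogonalProjectionOnto (K.starProjection (X (K.starProjection x)))) : H) =
    K.orthogonalProjectionOnto (X x)
  rw [h, h']

theorem ringInverse_eq_of_mul_eq_one {M : Type*} [MonoidWithZero M] {a b : M} (hab : a * b = 1)
    (hba : b * a = 1) : Ring.inverse a = b :=
  Ring.inverse_unit ⟨a, b, hab, hba⟩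

/-- The `P`-corner of `G²` is `EE*`, that is `1 + BB*`. As `|G|` commutes with `P`, its corner is a
positive square root of that, and such roots are unique. -/
theorem opT_blockB {E : H →L[ℂ] H} (hE : IsIdempotentElem E) :
    opT (blockB E) = compress (closedRange E) (absPart E) := by
  have h := isRangePair hE
  have hc : absPart E * rangeProj E = rangeProj E * absPart E :=
    IsRangePair.commute_absPart h.commute_left_sq
  refine CFC.sqrt_unique ?_ (compress_nonneg _ _ (CFC.sqrt_nonneg _))
  rw [compress_mul _ _ _ hc, h.absPart_mul_self]
  have hB : blockB E ∘L ContinuousLinearMap.adjoint (blockB E) =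
      compress (closedRange E) (E * (closedRange E)ᗮ.starProjection * star E) := by
    rw [blockB, ContinuousLinearMap.adjoint_comp, ContinuousLinearMap.adjoint_comp,
      Submodule.adjoint_subtypeL, Submodule.adjoint_orthogonalProjectionOnto]
    rfl
  rw [hB, Submodule.starProjection_orthogonal', ← compress_one, ← compress_add,
    ← compress_conj_starProjection _ (symPart E * symPart E),
    ← compress_conj_starProjection _ (1 + E * (1 - (closedRange E).starProjection) * star E)]
  congr 1
  change rangeProj E * (symPart E * symPart E) * rangeProj E =
    rangeProj E * (1 + E * (1 - rangeProj E) * star E) * rangeProj E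
  set P := rangeProj E
  have h1 : P * E = E := h.left_mul
  have h2 : E * P = P := h.mul_left
  have h3 : P * star E = P := h.star_mul_left
  have h4 : star E * P = star E := h.star_left_mul
  have hP : P * P = P := h.left.1
  have e1 : P * symPart E = E := by
    simp only [symPart, mul_add, mul_sub, mul_one, h1, h3]; abel
  have e2 : symPart E * P = star E := by
    simp only [symPart, add_mul, sub_mul, one_mul, h2, h4]; abel
  calc P * (symPart E * symPart E) * P = (P * symPart E) * (symPart E * P) := by noncomm_ring
    _ = E * star E := by rw [e1, e2]
    _ = P * P + (P * E) * (star E * P) - P * (E * P) * (star E * P) := by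
      rw [h1, h2, h4, hP, h3]; abel
    _ = P * (1 + E * (1 - P) * star E) * P := by noncomm_ring

/-- The first row and column match directly. In the last corner `B*B = N² - 1`, and `(N² - 1)/(N(N +
1)) = 1 - N⁻¹`, which agrees with the corner `-1` of `G`. -/
theorem matched_eq {E : H →L[ℂ] H} (hE : IsIdempotentElem E) {J : H →L[ℂ] H}
    (hJN : J * absPart E = 1) (hNJ : absPart E * J = 1) :
    matched E = (1 / 2 : ℂ) • (1 + J * symPart E) := by
  have h := isRangePair hE
  set N := absPart E with hN
  obtain ⟨u, hu⟩ : IsUnit (N + 1) :=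
    (IsStrictlyPositive.add_nonneg h.absPart_pos zero_le_one).isUnit
  set M : H →L[ℂ] H := ↑u⁻¹
  have hMN : M * (N + 1) = 1 := by rw [← hu]; exact u.inv_mul
  have hNM : (N + 1) * M = 1 := by rw [← hu]; exact u.mul_inv
  have hP : (closedRange E).starProjection = rangeProj E := rfl
  set P := rangeProj E with hPdef
  have cN : Commute N P := IsRangePair.commute_absPart h.commute_left_sq
  have cJ : Commute J P := commute_of_mul_eq_one hJN hNJ cN
  have cM : Commute M P := commute_of_mul_eq_one hMN hNM (cN.add_left (Commute.one_left P))
  have hT := opT_blockB hE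
  have hT1 : opT (blockB E) + 1 = compress (closedRange E) (N + 1) := by
    rw [hT, compress_add, compress_one]
  have hTinv : Ring.inverse (opT (blockB E)) = compress (closedRange E) J := by
    rw [hT]
    apply ringInverse_eq_of_mul_eq_one
    · rw [compress_mul _ _ _ cN, hNJ, compress_one]
    · rw [compress_mul _ _ _ cJ, hJN, compress_one]
  have hTTinv : Ring.inverse (opT (blockB E) * (opT (blockB E) + 1)) =
      compress (closedRange E) (M * J) := by
    rw [hT1, hT, compress_mul _ _ _ cN]
    apply ringInverse_eq_of_mul_eq_one
    · rw [compress_mul _ _ _ (cN.mul_left (cN.add_left (Commute.one_left P))),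
        mul_assoc, ← mul_assoc _ M, hNM, one_mul, hNJ, compress_one]
    · rw [compress_mul _ _ _ (cM.mul_left cJ),
        mul_assoc, ← mul_assoc J, hJN, one_mul, hMN, compress_one]
  have hadj : ContinuousLinearMap.adjoint (blockB E) =
      (closedRange E)ᗮ.orthogonalProjectionOnto ∘L star E ∘L (closedRange E).subtypeL := by
    rw [blockB, ContinuousLinearMap.adjoint_comp, ContinuousLinearMap.adjoint_comp,
      Submodule.adjoint_subtypeL, Submodule.adjoint_orthogonalProjectionOnto]
    rfl
  rw [matched, block11, block12, block21, block22, hTTinv, hTinv, hT1, hadj,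
    compress_mul _ _ _ (cN.add_left (Commute.one_left P)), ofBlocks]
  congr 1
  trans P * ((N + 1) * J) * P + P * J * P * E * (1 - P) +
    ((1 - P) * star E * P * J * P + (1 - P) * star E * P * (M * J) * P * E * (1 - P))
  · rw [← hP, ← Submodule.starProjection_orthogonal']
    ext x
    simp only [add_apply]
    rfl
  have h1 : P * E = E := h.left_mul
  have h2 : E * P = P := h.mul_left
  have h3 : P * star E = P := h.star_mul_left
  have h4 : star E * P = star E := h.star_left_mul
  have hPP : P * P = P := h.left.1
  have e1 : P * symPart E = E := by
    simp only [symPart, mul_add, mul_sub, mul_one, h1, h3]; abel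
  have e2 : symPart E * P = star E := by
    simp only [symPart, add_mul, sub_mul, one_mul, h2, h4]; abel
  have cG : Commute N (symPart E) :=
    IsRangePair.commute_absPart ((Commute.refl (symPart E)).mul_left (Commute.refl _))
  have cS : Commute N (star E) := e2 ▸ cG.mul_right cN
  have cSP : Commute N (star E - P) := cS.sub_right cN
  have cJS : J * (star E - P) = (star E - P) * J := commute_of_mul_eq_one hJN hNJ cSP
  have cMS : M * (star E - P) = (star E - P) * M :=
    commute_of_mul_eq_one hMN hNM (cSP.add_left (Commute.one_left _))
  have a1 : (N + 1) * J = 1 + J := by rw [add_mul, hNJ, one_mul]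
  have a2 : (1 - P) * star E * P = star E - P := by
    rw [mul_assoc, h4, sub_mul, one_mul, h3]
  have a3 : P * E * (1 - P) = E - P := by rw [h1, mul_sub, mul_one, h2]
  -- This is `B*B = N² - 1` on `R(E)ᗮ`.
  have a4 : (star E - P) * (E - P) = (N * N - 1) * (1 - P) := by
    have hG : symPart E * symPart E * (1 - P) =
        symPart E * symPart E - symPart E * (symPart E * P) := by noncomm_ring
    rw [hN, h.absPart_mul_self, sub_mul _ _ (1 - P), hG, e2]
    simp only [symPart, mul_add, add_mul, mul_sub, sub_mul, mul_one, one_mul, h1, h4, hPP,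
      hE.eq, hE.star.eq]
    abel
  have a5 : M * (N - J) = 1 - J := by
    have : N - J = (N + 1) * (1 - J) := by rw [mul_sub, a1, mul_one]; abel
    rw [this, ← mul_assoc, hMN, one_mul]
  have t2 : P * J * P * E * (1 - P) = J * (E - P) := by
    rw [← a3, ← cJ.eq, mul_assoc J P P, hPP]; simp only [mul_assoc]
  have t3 : (1 - P) * star E * P * J * P = J * (star E - P) := by
    rw [a2, mul_assoc, cJ.eq, ← mul_assoc, sub_mul, h4, hPP, cJS]
  have t4 : (1 - P) * star E * P * (M * J) * P * E * (1 - P) = (1 - J) * (1 - P) := by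
    calc (1 - P) * star E * P * (M * J) * P * E * (1 - P)
        = (1 - P) * star E * P * (M * J) * (P * E * (1 - P)) := by simp only [mul_assoc]
      _ = M * J * ((star E - P) * (E - P)) := by
        rw [a2, a3, ← mul_assoc (star E - P) M, ← cMS, mul_assoc M, ← cJS]; simp only [mul_assoc]
      _ = M * (J * N * N - J) * (1 - P) := by rw [a4]; noncomm_ring
      _ = (1 - J) * (1 - P) := by rw [hJN, one_mul, a5]
  rw [a1, t2, t3, t4, mul_add, add_mul, ← cJ.eq, mul_one, mul_assoc, hPP, symPart]
  noncomm_ring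

end Range

/-! ### Exponential curves of projections. -/

section ExpCurve

open NormedSpace

variable {A : Type*} [CStarAlgebra A]

/-- Conjugation by `S` sends `Y` to `-Y`, hence `exp Y` to `exp (-Y)`. -/
theorem exp_mul_of_anticomm {S Y : A} (hS : S * S = 1) (hY : Y * S = -(S * Y)) :
    exp Y * S = S * exp (-Y) := by
  let +nondep : NormedAlgebra ℚ A := .restrictScalars ℚ ℂ A
  have h := exp_units_conj (⟨S, S, hS, hS⟩ : Aˣ) Y
  simp only [Units.val_mk, Units.inv_mk] at h
  have h2 : S * Y * S = -Y := by rw [mul_assoc, hY, mul_neg, ← mul_assoc, hS, one_mul]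
  rw [h2] at h
  rw [h, ← mul_assoc, ← mul_assoc, hS, one_mul]

theorem exp_mul_exp_neg (Y : A) : exp Y * exp (-Y) = 1 := by
  let +nondep : NormedAlgebra ℚ A := .restrictScalars ℚ ℂ A
  rw [← exp_add_of_commute (Commute.neg_right (Commute.refl Y)), add_neg_cancel, exp_zero]

theorem exp_mem_unitary_of_star_eq_neg {Y : A} (hY : star Y = -Y) : exp Y ∈ unitary A := by
  let +nondep : NormedAlgebra ℚ A := .restrictScalars ℚ ℂ A
  exact exp_mem_unitary_of_mem_skewAdjoint hY

theorem isStarProjection_of_symmetry {R : A} (h1 : star R = R) (h2 : R * R = 1) :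
    IsStarProjection ((1 / 2 : ℝ) • (1 + R)) where
  isIdempotentElem := by
    have : (1 + R) * (1 + R) = (2 : ℝ) • (1 + R) := by
      rw [mul_add, add_mul, add_mul, h2, two_smul]; simp only [mul_one, one_mul]; abel
    rw [IsIdempotentElem, smul_mul_smul_comm, this, smul_smul]
    norm_num
  isSelfAdjoint := by
    rw [IsSelfAdjoint, star_smul, star_add, star_one, h1]; simp

/-- The curve `t ↦ ½ (1 + exp (t Y) S)`. -/
noncomputable def expCurve (S Y : A) (t : ℝ) : A := (1 / 2 : ℝ) • (1 + exp (t • Y) * S)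

theorem isStarProjection_expCurve {S Y : A} (hSs : star S = S) (hS : S * S = 1)
    (hYs : star Y = -Y) (hY : Y * S = -(S * Y)) (t : ℝ) : IsStarProjection (expCurve S Y t) := by
  have h : exp (t • Y) * S = S * exp (-(t • Y)) :=
    exp_mul_of_anticomm hS (by rw [smul_mul_assoc, hY, mul_smul_comm, smul_neg])
  apply isStarProjection_of_symmetry
  · rw [star_mul, hSs, star_exp, star_smul, hYs, h]
    simp
  · nth_rewrite 2 [h]
    rw [mul_assoc, ← mul_assoc S, hS, one_mul, exp_mul_exp_neg]

theorem hasDerivAt_expCurve (S Y : A) (t : ℝ) :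
    HasDerivAt (expCurve S Y) ((1 / 2 : ℝ) • (Y * exp (t • Y) * S)) t := by
  exact (((hasDerivAt_exp_smul_const' Y t).mul_const S).const_add 1).const_smul (1 / 2 : ℝ)

theorem contDiff_expCurve (S Y : A) : ContDiff ℝ ∞ (expCurve S Y) := by
  have h : ContDiff ℝ ∞ (exp : A → A) :=
    contDiff_iff_contDiffAt.2 fun x => (exp_analytic (𝕂 := ℝ) x).contDiffAt
  unfold expCurve
  fun_prop

theorem norm_deriv_expCurve {S Y : A} (hSs : star S = S) (hS : S * S = 1)
    (hYs : star Y = -Y) (t : ℝ) : ‖deriv (expCurve S Y) t‖ = ‖Y‖ / 2 := by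
  have h1 : S ∈ unitary A := by rw [Unitary.mem_iff, hSs]; exact ⟨hS, hS⟩
  have h2 : exp (t • Y) ∈ unitary A :=
    exp_mem_unitary_of_star_eq_neg (by rw [star_smul, hYs, smul_neg]; rfl)
  rw [(hasDerivAt_expCurve S Y t).deriv, norm_smul, CStarRing.norm_mul_mem_unitary _ h1,
    CStarRing.norm_mul_mem_unitary _ h2]
  norm_num
  ring

end ExpCurve

/-! ### Geodesics are exactly the exponential curves. -/

section Geodesic

variable {H : Type*} [NormedAddCommGroup H] [InnerProductSpace ℂ H] [CompleteSpace H]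

open NormedSpace Set

theorem length_congr {H : Type*} [NormedAddCommGroup H] [InnerProductSpace ℂ H] {c₁ c₂ : ℝ → H →L[ℂ] H} (h : EqOn c₁ c₂ (Icc 0 1)) :
    length c₁ = length c₂ := by
  unfold length
  -- `deriv` at `0` and `1` depends on values outside `[0,1]`, so the end points are discarded
  -- first.
  rw [intervalIntegral.integral_of_le zero_le_one, intervalIntegral.integral_of_le zero_le_one,
    MeasureTheory.integral_Ioc_eq_integral_Ioo, MeasureTheory.integral_Ioc_eq_integral_Ioo]
  refine MeasureTheory.setIntegral_congr_fun measurableSet_Ioo fun t ht => ?_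
  have : c₁ =ᶠ[nhds t] c₂ :=
    (h.mono Ioo_subset_Icc_self).eventuallyEq_of_mem (Ioo_mem_nhds ht.1 ht.2)
  simp only [this.deriv_eq]

theorem length_expCurve {S Y : H →L[ℂ] H} (hSs : star S = S) (hS : S * S = 1)
    (hYs : star Y = -Y) : length (expCurve S Y) = ‖Y‖ / 2 := by
  simp [length, norm_deriv_expCurve hSs hS hYs]

theorem codiag_eq_zero_of_commute {P Z : H →L[ℂ] H} (hP : IsStarProjection P)
    (h : P * Z = Z * P) : codiag P Z = 0 := by
  have h2 : P * P = P := hP.1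
  rw [codiag, h, mul_assoc, hP.mul_one_sub_self, mul_assoc, ← h, ← mul_assoc,
    hP.one_sub_mul_self]
  simp

/-- The second derivative is `½ Y² exp(tY) S`. Since `Y²` commutes with both `Y` and `S`, it
commutes with the curve and has no co-diagonal part. -/
theorem isGeodesic_expCurve {S Y : H →L[ℂ] H} (hSs : star S = S) (hS : S * S = 1)
    (hYs : star Y = -Y) (hY : Y * S = -(S * Y)) : IsGeodesic (expCurve S Y) where
  smooth := (contDiff_expCurve S Y).contDiffOn
  isProj t _ := isStarProjection_expCurve hSs hS hYs hY t
  parallel t ht := by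
    have hu : UniqueDiffOn ℝ (Icc (0 : ℝ) 1) := uniqueDiffOn_Icc zero_lt_one
    have h1 : EqOn (derivWithin (expCurve S Y) (Icc 0 1))
        (fun t => (1 / 2 : ℝ) • (Y * exp (t • Y) * S)) (Icc 0 1) := fun t ht =>
      (hasDerivAt_expCurve S Y t).hasDerivWithinAt.derivWithin (hu t ht)
    have h2 : HasDerivAt (fun t : ℝ => (1 / 2 : ℝ) • (Y * exp (t • Y) * S))
        ((1 / 2 : ℝ) • (Y * (Y * exp (t • Y)) * S)) t :=
      ((((hasDerivAt_exp_smul_const' Y t).const_mul Y).mul_const S)).const_smul (1 / 2 : ℝ)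
    rw [covDeriv, derivWithin_congr h1 (h1 ht), h2.hasDerivWithinAt.derivWithin (hu t ht)]
    apply codiag_eq_zero_of_commute (isStarProjection_expCurve hSs hS hYs hY t)
    have hYE : Y * exp (t • Y) = exp (t • Y) * Y :=
      ((Commute.refl Y).smul_right t).exp_right
    have hYYE : Commute (Y * Y) (exp (t • Y) * S) := by
      have a : Commute (Y * Y) (exp (t • Y)) := Commute.mul_left hYE hYE
      have b : Commute (Y * Y) S := by
        rw [Commute, SemiconjBy, mul_assoc, hY, mul_neg, ← mul_assoc, hY, neg_mul, neg_neg,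
          mul_assoc]
      exact a.mul_right b
    have hc : Commute (expCurve S Y t) (Y * Y) :=
      (((Commute.one_right _).add_right hYYE).smul_right _).symm
    have hZ : Y * (Y * exp (t • Y)) * S = Y * Y * (exp (t • Y) * S) := by simp only [mul_assoc]
    rw [hZ]
    refine Commute.smul_right (hc.mul_right ?_) _
    exact (((Commute.one_right _).add_right (Commute.refl _)).smul_right _).symm

/-- Every geodesic of projections is the orbit of a one-parameter group. -/
theorem IsGeodesic.exists_eqOn_expCurve {γ : ℝ → H →L[ℂ] H} (hγ : IsGeodesic γ) :
    ∃ Y : H →L[ℂ] H, star Y = -Y ∧ Y * (2 * γ 0 - 1) = -((2 * γ 0 - 1) * Y) ∧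
      EqOn γ (expCurve (2 * γ 0 - 1) Y) (Icc 0 1) := by
  set s : Set ℝ := Icc 0 1 with hs
  have hu : UniqueDiffOn ℝ s := uniqueDiffOn_Icc zero_lt_one
  have h0 : (0 : ℝ) ∈ s := ⟨le_rfl, zero_le_one⟩
  set γ' := derivWithin γ s with hγ'
  have hd : ∀ t ∈ s, HasDerivWithinAt γ (γ' t) s t := fun t ht =>
    ((hγ.smooth.differentiableOn (by simp)) t ht).hasDerivWithinAt
  have hd' : ∀ t ∈ s, HasDerivWithinAt γ' (derivWithin γ' s t) s t := fun t ht =>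
    (((hγ.smooth.derivWithin (m := ∞) hu le_rfl).differentiableOn (by simp))
      t ht).hasDerivWithinAt
  have hidem : ∀ t ∈ s, γ t * γ t = γ t := fun t ht => (hγ.isProj t ht).1
  have hsa : ∀ t ∈ s, star (γ t) = γ t := fun t ht => (hγ.isProj t ht).2
  have hidem' : ∀ t ∈ s, γ' t * γ t + γ t * γ' t = γ' t := fun t ht =>
    (hu t ht).eq_deriv _ (((hd t ht).mul (hd t ht)).congr (fun x hx => (hidem x hx).symm)
      (hidem t ht).symm) (hd t ht)
  have hsa' : ∀ t ∈ s, star (γ' t) = γ' t := fun t ht =>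
    (hu t ht).eq_deriv _ ((hd t ht).star.congr (fun x hx => (hsa x hx).symm)
      (hsa t ht).symm) (hd t ht)
  -- The derivative of `[γ', γ]` is `[γ'', γ]`, and this vanishes because `γ''` is block diagonal.
  have hX' : ∀ t ∈ s, HasDerivWithinAt (fun t => γ' t * γ t - γ t * γ' t) 0 s t := by
    intro t ht
    have hp : codiag (γ t) (derivWithin γ' s t) = 0 := hγ.parallel t ht
    have hP := hγ.isProj t ht
    set D := derivWithin γ' s t
    have e1 : γ t * D * γ t = γ t * D := by
      have := congrArg (γ t * ·) hp
      simp only [codiag, mul_add, ← mul_assoc, hidem t ht, hP.mul_one_sub_self, zero_mul,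
        mul_zero, add_zero] at this
      rw [mul_sub, mul_one, sub_eq_zero] at this
      exact this.symm
    have e2 : γ t * D * γ t = D * γ t := by
      have := congrArg (· * γ t) hp
      simp only [codiag, add_mul, mul_assoc, hidem t ht, hP.one_sub_mul_self, zero_mul,
        mul_zero, zero_add] at this
      rw [sub_mul, one_mul, sub_eq_zero] at this
      rw [mul_assoc, ← this]
    have := ((hd' t ht).mul (hd t ht)).sub ((hd t ht).mul (hd' t ht))
    have e : D * γ t + γ' t * γ' t - (γ' t * γ' t + γ t * D) = 0 := by
      rw [← e1, ← e2]
      abel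
    exact e ▸ this
  have hXc : ∀ t ∈ s, γ' t * γ t - γ t * γ' t = γ' 0 * γ 0 - γ 0 * γ' 0 := by
    apply constant_of_derivWithin_zero (fun t ht => (hX' t ht).differentiableWithinAt)
    exact fun t ht => (hX' t (Ico_subset_Icc_self ht)).derivWithin (hu t (Ico_subset_Icc_self ht))
  set X := γ' 0 * γ 0 - γ 0 * γ' 0 with hX
  have hcross : ∀ t ∈ s, γ t * γ' t * γ t = 0 := by
    intro t ht
    have h1 := congrArg (fun Z => γ t * Z * γ t) (hidem' t ht)
    simp only [mul_add, add_mul, ← mul_assoc, hidem t ht] at h1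
    rw [mul_assoc _ (γ t) (γ t), hidem t ht] at h1
    simpa using h1
  have hXanti : ∀ t ∈ s, X * (2 * γ t - 1) = -((2 * γ t - 1) * X) := by
    intro t ht
    have h1 : X * γ t + γ t * X = X := by
      rw [← hXc t ht]
      simp only [mul_sub, sub_mul, ← mul_assoc, hidem t ht]
      rw [mul_assoc _ (γ t) (γ t), hidem t ht]
      abel
    rw [← add_eq_zero_iff_eq_neg]
    calc X * (2 * γ t - 1) + (2 * γ t - 1) * X = 2 * (X * γ t + γ t * X) - 2 * X := by
          noncomm_ring
      _ = 0 := by rw [h1, sub_self]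
  have hode : ∀ t ∈ s, γ' t = X * (2 * γ t - 1) := by
    intro t ht
    rw [← hXc t ht]
    have h1 : (γ' t * γ t - γ t * γ' t) * (2 * γ t - 1) =
        2 * (γ' t * (γ t * γ t)) - γ' t * γ t - 2 * (γ t * γ' t * γ t) + γ t * γ' t := by
      noncomm_ring
    rw [h1, hidem t ht, hcross t ht]
    nth_rewrite 1 [← hidem' t ht]
    noncomm_ring
  -- The symmetry `R = 2γ - 1` solves `R' = 2XR`, hence the factor `2`; `exp(-tY)` is the
  -- integrating factor.
  set Y : H →L[ℂ] H := (2 : ℝ) • X with hY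
  have hconst : ∀ t ∈ s, exp (t • (-Y)) * (2 * γ t - 1) = exp ((0 : ℝ) • (-Y)) * (2 * γ 0 - 1) := by
    have hder : ∀ t ∈ s, HasDerivWithinAt (fun t : ℝ => exp (t • (-Y)) * (2 * γ t - 1)) 0 s t := by
      intro t ht
      have := (hasDerivAt_exp_smul_const (-Y) t).hasDerivWithinAt (s := s) |>.mul
        (((hd t ht).const_mul 2).sub_const 1)
      have e : exp (t • -Y) * -Y * (2 * γ t - 1) + exp (t • -Y) * (2 * γ' t) = 0 := by
        rw [hode t ht, hY, two_smul]
        noncomm_ring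
      exact e ▸ this
    apply constant_of_derivWithin_zero (fun t ht => (hder t ht).differentiableWithinAt)
    exact fun t ht => (hder t (Ico_subset_Icc_self ht)).derivWithin (hu t (Ico_subset_Icc_self ht))
  refine ⟨Y, ?_, ?_, fun t ht => ?_⟩
  · rw [hY, star_smul, hX, star_sub, star_mul, star_mul, hsa 0 h0, hsa' 0 h0, ← smul_neg, neg_sub]
    rfl
  · rw [hY, smul_mul_assoc, hXanti 0 h0, mul_smul_comm, smul_neg]
  · have h1 := congrArg (exp (t • Y) * ·) (hconst t ht)
    simp only [smul_neg, zero_smul, neg_zero, exp_zero, one_mul, ← mul_assoc,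
      exp_mul_exp_neg] at h1
    rw [expCurve, ← h1, add_sub_cancel, two_mul, ← two_smul ℝ, smul_smul]
    norm_num

end Geodesic

/-! ### A scalar estimate for the variation of an angle. -/

section Scalar

open Set Filter

theorem abs_arccos_sub_arccos_le {u v : ℝ → ℝ} {a b : ℝ} (hab : a ≤ b)
    (huc : ContinuousOn u (Icc a b)) (hud : DifferentiableOn ℝ u (Ioo a b))
    (hu1 : ∀ t ∈ Icc a b, |u t| ≤ 1)
    (hder : ∀ t ∈ Ioo a b, |deriv u t| ≤ v t * √(1 - u t ^ 2))
    (hv0 : ∀ t, 0 ≤ v t) (hv : IntervalIntegrable v MeasureTheory.volume a b) :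
    |Real.arccos (u b) - Real.arccos (u a)| ≤ ∫ t in a..b, v t := by
  -- `arccos` is not differentiable at `±1`; the estimate is proved for `r * u` with `r < 1`, and
  -- then `r → 1`.
  have key : ∀ r ∈ Ioo (0 : ℝ) 1,
      |Real.arccos (r * u b) - Real.arccos (r * u a)| ≤ ∫ t in a..b, v t := by
    intro r hr
    have hlt : ∀ t ∈ Icc a b, |r * u t| < 1 := fun t ht => by
      rw [abs_mul, abs_of_pos hr.1]
      exact (mul_le_of_le_one_right hr.1.le (hu1 t ht)).trans_lt hr.2
    have hd : ∀ t ∈ Ioo a b, HasDerivAt (fun t => Real.arccos (r * u t))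
        (-(1 / √(1 - (r * u t) ^ 2)) * (r * deriv u t)) t := fun t ht => by
      have h1 := abs_lt.1 (hlt t (Ioo_subset_Icc_self ht))
      exact HasDerivAt.comp (h₂ := Real.arccos) t (Real.hasDerivAt_arccos h1.1.ne' h1.2.ne)
        ((hud.hasDerivAt (Ioo_mem_nhds ht.1 ht.2)).const_mul r)
    refine norm_sub_le_integral_of_norm_deriv_le_of_le (f := fun t => Real.arccos (r * u t)) hab
      (Real.continuous_arccos.comp_continuousOn (huc.const_smul r))
      (fun t ht => (hd t ht).differentiableAt.differentiableWithinAt)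
      (Eventually.of_forall fun t ht => ?_) hv
    have h1 := hlt t (Ioo_subset_Icc_self ht)
    have hpos : 0 < √(1 - (r * u t) ^ 2) :=
      Real.sqrt_pos.2 (sub_pos.2 ((sq_lt_one_iff_abs_lt_one _).2 h1))
    rw [(hd t ht).deriv, Real.norm_eq_abs, abs_mul, abs_neg, abs_of_pos (one_div_pos.2 hpos),
      one_div_mul_eq_div, div_le_iff₀ hpos, abs_mul, abs_of_pos hr.1]
    calc r * |deriv u t| ≤ r * (v t * √(1 - u t ^ 2)) :=
          mul_le_mul_of_nonneg_left (hder t ht) hr.1.le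
      _ = v t * √(r ^ 2 * (1 - u t ^ 2)) := by
          rw [Real.sqrt_mul (sq_nonneg r), Real.sqrt_sq hr.1.le]; ring
      _ ≤ v t * √(1 - (r * u t) ^ 2) := by
          refine mul_le_mul_of_nonneg_left (Real.sqrt_le_sqrt ?_) (hv0 t)
          nlinarith [hr.1, hr.2]
  have hlim : Tendsto (fun r : ℝ => |Real.arccos (r * u b) - Real.arccos (r * u a)|)
      (nhdsWithin 1 (Iio 1)) (nhds |Real.arccos (1 * u b) - Real.arccos (1 * u a)|) := by
    refine Tendsto.mono_left (Continuous.tendsto ?_ 1) nhdsWithin_le_nhds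
    have := Real.continuous_arccos
    fun_prop
  rw [one_mul, one_mul] at hlim
  refine le_of_tendsto hlim ?_
  filter_upwards [Ioo_mem_nhdsLT (zero_lt_one (α := ℝ))] with r hr using key r hr

end Scalar

/-! ### The angle seen by a unit vector, and the lower bound for lengths. -/

section Vector

open Set MeasureTheory

variable {H : Type*} [NormedAddCommGroup H] [InnerProductSpace ℂ H]

/-- The real linear functional `X ↦ Re ⟪ξ, X ξ⟫` on operators. -/
noncomputable def reInner (ξ : H) : (H →L[ℂ] H) →L[ℝ] ℝ :=
  Complex.reCLM ∘L ((innerSL ℂ ξ).restrictScalars ℝ) ∘L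
    ((ContinuousLinearMap.apply ℂ H ξ).restrictScalars ℝ)

theorem reInner_apply (ξ : H) (X : H →L[ℂ] H) : reInner ξ X = (inner ℂ ξ (X ξ)).re := rfl

variable [CompleteSpace H]

theorem reInner_star_mul (ξ : H) (X Y : H →L[ℂ] H) :
    reInner ξ (star X * Y) = (inner ℂ (X ξ) (Y ξ)).re := by
  rw [reInner_apply]
  exact congrArg Complex.re (ContinuousLinearMap.adjoint_inner_right X ξ (Y ξ))

theorem reInner_star_mul_self (ξ : H) (X : H →L[ℂ] H) :
    reInner ξ (star X * X) = ‖X ξ‖ ^ 2 := by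
  rw [reInner_star_mul]
  exact inner_self_eq_norm_sq (𝕜 := ℂ) (X ξ)

theorem reInner_one (ξ : H) : reInner ξ (1 : H →L[ℂ] H) = ‖ξ‖ ^ 2 := by
  simpa using reInner_star_mul_self ξ 1

theorem reInner_star (ξ : H) (X : H →L[ℂ] H) : reInner ξ (star X) = reInner ξ X := by
  have h := reInner_star_mul ξ X 1
  rw [mul_one] at h
  rw [h, reInner_apply, ← inner_conj_symm]
  rfl

theorem reInner_of_isStarProjection {P : H →L[ℂ] H} (hP : IsStarProjection P) (ξ : H) :
    reInner ξ P = ‖P ξ‖ ^ 2 := by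
  rw [← reInner_star_mul_self, hP.2.star_eq, hP.1.eq]

theorem norm_sq_eq_add_of_isStarProjection {P : H →L[ℂ] H} (hP : IsStarProjection P) (ξ : H) :
    ‖ξ‖ ^ 2 = ‖P ξ‖ ^ 2 + ‖(1 - P) ξ‖ ^ 2 := by
  rw [← reInner_of_isStarProjection hP, ← reInner_of_isStarProjection hP.one_sub, ← map_add,
    add_sub_cancel, reInner_one]

theorem reInner_symmetry {P : H →L[ℂ] H} (hP : IsStarProjection P) (ξ : H) :
    reInner ξ (2 * P - 1) = ‖P ξ‖ ^ 2 - ‖(1 - P) ξ‖ ^ 2 := by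
  rw [← reInner_of_isStarProjection hP, ← reInner_of_isStarProjection hP.one_sub, ← map_sub]
  congr 1
  noncomm_ring

/-- If `D` anticommutes with the symmetry `R`, then `⟪ξ, D ξ⟫` only sees the component of `ξ`
orthogonal to `R ξ`. -/
theorem abs_reInner_le {R D : H →L[ℂ] H} (hRs : star R = R) (hR : R * R = 1)
    (hDs : star D = D) (hD : D * R = -(R * D)) {ξ : H} (hξ : ‖ξ‖ = 1) :
    |reInner ξ D| ≤ ‖D‖ * √(1 - reInner ξ R ^ 2) := by
  set u := reInner ξ R with hu
  set Z : H →L[ℂ] H := 1 - u • R with hZ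
  have hZs : star Z = Z := by rw [hZ, star_sub, star_one, star_smul, hRs]; rfl
  -- `RD` is skew-adjoint, so its quadratic form has zero real part.
  have hRD : reInner ξ (R * D) = 0 := by
    have h := reInner_star ξ (R * D)
    rw [star_mul, hRs, hDs, hD, map_neg] at h
    linarith
  have h1 : reInner ξ D = (inner ℂ (Z ξ) (D ξ)).re := by
    rw [← reInner_star_mul, hZs, hZ, sub_mul, one_mul, smul_mul_assoc, map_sub, map_smul, hRD,
      smul_zero, sub_zero]
  have h2 : ‖Z ξ‖ ^ 2 = 1 - u ^ 2 := by
    have : Z * Z = 1 - (2 * u) • R + (u ^ 2) • (1 : H →L[ℂ] H) := by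
      simp only [hZ, sub_mul, mul_sub, one_mul, mul_one, smul_mul_smul_comm, hR, two_mul, add_smul,
        sq]
      abel
    rw [← reInner_star_mul_self, hZs, this, map_add, map_sub, map_smul, map_smul, reInner_one, hξ,
      ← hu]
    simp only [smul_eq_mul]
    ring
  rw [h1, ← h2, Real.sqrt_sq (norm_nonneg _)]
  calc |(inner ℂ (Z ξ) (D ξ)).re| ≤ ‖inner ℂ (Z ξ) (D ξ)‖ := Complex.abs_re_le_norm _
    _ ≤ ‖Z ξ‖ * ‖D ξ‖ := norm_inner_le_norm _ _
    _ ≤ ‖Z ξ‖ * (‖D‖ * 1) := by rw [← hξ]; gcongr; exact D.le_opNorm ξ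
    _ = ‖D‖ * ‖Z ξ‖ := by ring

theorem abs_reInner_symmetry_le_one {P : H →L[ℂ] H} (hP : IsStarProjection P) {ξ : H}
    (hξ : ‖ξ‖ = 1) : |reInner ξ (2 * P - 1)| ≤ 1 := by
  have h1 := norm_sq_eq_add_of_isStarProjection hP ξ
  rw [hξ] at h1
  rw [reInner_symmetry hP, abs_le]
  constructor <;> nlinarith [sq_nonneg ‖P ξ‖, sq_nonneg ‖(1 - P) ξ‖]

/-- Along a smooth arc of projections, the angle seen by a unit vector varies at most with twice
the length of the arc. -/
theorem abs_arccos_sub_arccos_le_of_contDiffOn {c : ℝ → H →L[ℂ] H} {a b : ℝ} (hab : a ≤ b)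
    (hc : ContDiffOn ℝ ∞ c (Icc a b)) (hP : ∀ t ∈ Icc a b, IsStarProjection (c t))
    {ξ : H} (hξ : ‖ξ‖ = 1) :
    IntervalIntegrable (fun t => ‖deriv c t‖) volume a b ∧
      |Real.arccos (reInner ξ (2 * c b - 1)) - Real.arccos (reInner ξ (2 * c a - 1))| ≤
        2 * ∫ t in a..b, ‖deriv c t‖ := by
  -- Break points are only monotone, so a piece may be a single point.
  rcases hab.eq_or_lt with rfl | hlt
  · simp
  have hd : ∀ t ∈ Ioo a b, HasDerivAt c (deriv c t) t := fun t ht =>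
    (((hc.differentiableOn (by simp)) t (Ioo_subset_Icc_self ht)).differentiableAt
      (Icc_mem_nhds ht.1 ht.2)).hasDerivAt
  have hint : IntervalIntegrable (fun t => ‖deriv c t‖) volume a b := by
    have h1 : ContinuousOn (fun t => ‖derivWithin c (Icc a b) t‖) (Icc a b) :=
      (hc.continuousOn_derivWithin (uniqueDiffOn_Icc hlt) (by simp)).norm
    have h2 : IntervalIntegrable (fun t => ‖derivWithin c (Icc a b) t‖) volume a b :=
      h1.intervalIntegrable_of_Icc hab
    refine h2.congr_ae ?_
    rw [uIoc_of_le hab, ← Measure.restrict_congr_set Ioo_ae_eq_Ioc, Filter.EventuallyEq,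
      ae_restrict_iff' measurableSet_Ioo]
    exact Filter.Eventually.of_forall fun t ht => by
      rw [derivWithin_of_mem_nhds (Icc_mem_nhds ht.1 ht.2)]
  refine ⟨hint, ?_⟩
  rw [← intervalIntegral.integral_const_mul]
  have hud : ∀ t ∈ Ioo a b, HasDerivAt (fun t => reInner ξ (2 * c t - 1))
      (reInner ξ (2 * deriv c t)) t := fun t ht =>
    (reInner ξ).hasFDerivAt.comp_hasDerivAt t (((hd t ht).const_mul 2).sub_const 1)
  refine abs_arccos_sub_arccos_le (u := fun t => reInner ξ (2 * c t - 1)) hab ?_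
    (fun t ht => (hud t ht).differentiableAt.differentiableWithinAt)
    (fun t ht => abs_reInner_symmetry_le_one (hP t ht) hξ) (fun t ht => ?_)
    (fun t => by positivity) (hint.const_mul 2)
  · exact (reInner ξ).continuous.comp_continuousOn
      ((continuousOn_const.mul hc.continuousOn).sub continuousOn_const)
  · have ht' := Ioo_subset_Icc_self ht
    have hmem := Icc_mem_nhds ht.1 ht.2
    have hidem' : deriv c t * c t + c t * deriv c t = deriv c t := by
      refine ((hd t ht).mul (hd t ht)).unique ((hd t ht).congr_of_eventuallyEq ?_)
      filter_upwards [hmem] with x hx using (hP x hx).1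
    have hsa' : star (deriv c t) = deriv c t := by
      refine (hd t ht).star.unique ((hd t ht).congr_of_eventuallyEq ?_)
      filter_upwards [hmem] with x hx using (hP x hx).2
    have hRs : star (2 * c t - 1) = 2 * c t - 1 := by simp [two_mul, (hP t ht').2.star_eq]
    have hR : (2 * c t - 1) * (2 * c t - 1) = 1 := by
      have : (2 * c t - 1) * (2 * c t - 1) = 4 * (c t * c t) - 4 * c t + 1 := by noncomm_ring
      rw [this, (hP t ht').1.eq]; noncomm_ring
    have hD : (2 * deriv c t) * (2 * c t - 1) = -((2 * c t - 1) * (2 * deriv c t)) := by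
      rw [← add_eq_zero_iff_eq_neg]
      have : (2 * deriv c t) * (2 * c t - 1) + (2 * c t - 1) * (2 * deriv c t) =
        4 * (deriv c t * c t + c t * deriv c t) - 4 * deriv c t := by noncomm_ring
      rw [this, hidem', sub_self]
    have h := abs_reInner_le hRs hR (D := 2 * deriv c t) (by simp [two_mul, hsa']) hD hξ
    rw [(hud t ht).deriv]
    refine h.trans (mul_le_mul_of_nonneg_right ?_ (Real.sqrt_nonneg _))
    rw [two_mul, two_mul]
    exact norm_add_le _ _

theorem IsPiecewiseSmoothCurve.abs_arccos_sub_arccos_le {c : ℝ → H →L[ℂ] H}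
    (hc : IsPiecewiseSmoothCurve c) {ξ : H} (hξ : ‖ξ‖ = 1) :
    |Real.arccos (reInner ξ (2 * c 1 - 1)) - Real.arccos (reInner ξ (2 * c 0 - 1))| ≤
      2 * length c := by
  obtain ⟨n, τ, hτ, hτ0, hτn, hs⟩ := hc.pieces
  -- Integrability is carried through the induction so that the integrals over adjacent pieces can
  -- be added.
  have key : ∀ k ≤ n, IntervalIntegrable (fun t => ‖deriv c t‖) volume 0 (τ k) ∧
      |Real.arccos (reInner ξ (2 * c (τ k) - 1)) - Real.arccos (reInner ξ (2 * c 0 - 1))| ≤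
        2 * ∫ t in (0 : ℝ)..τ k, ‖deriv c t‖ := by
    intro k
    induction k with
    | zero => simp [hτ0]
    | succ k ih =>
      intro hk
      obtain ⟨hi, hle⟩ := ih (by omega)
      obtain ⟨hi', hle'⟩ := abs_arccos_sub_arccos_le_of_contDiffOn (hτ k.le_succ) (hs k hk)
        (fun t ht => hc.isProj t ⟨(hτ0 ▸ hτ k.zero_le).trans ht.1,
          ht.2.trans (hτn ▸ hτ hk)⟩) hξ
      refine ⟨hi.trans hi', ?_⟩
      rw [← intervalIntegral.integral_add_adjacent_intervals hi hi', mul_add]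
      exact (abs_sub_le _ _ _).trans (by linarith)
  have := (key n le_rfl).2
  rwa [hτn] at this

/-- A unit vector in the range of `P` starts at angle `0` and one in the kernel at angle `π`; each
moves by at most `2L`. This bounds `(1 - Q)P` and `Q(1 - P)` by `sin L`, and up to sign these are
the two components of `P - Q`, combined by Pythagoras. -/
theorem IsPiecewiseSmoothCurve.norm_sub_le_sin {c : ℝ → H →L[ℂ] H}
    (hc : IsPiecewiseSmoothCurve c) (hL : length c ≤ Real.pi / 2) :
    ‖c 0 - c 1‖ ≤ Real.sin (length c) := by
  have hP := hc.isProj 0 ⟨le_rfl, zero_le_one⟩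
  have hQ := hc.isProj 1 ⟨zero_le_one, le_rfl⟩
  have hL0 : 0 ≤ length c :=
    intervalIntegral.integral_nonneg zero_le_one fun t _ => norm_nonneg _
  have hsin : 0 ≤ Real.sin (length c) :=
    Real.sin_nonneg_of_nonneg_of_le_pi hL0 (by linarith [Real.pi_pos])
  have hcos : Real.cos (2 * length c) = 1 - 2 * Real.sin (length c) ^ 2 := by
    rw [Real.cos_two_mul, Real.cos_sq']; ring
  set P := c 0
  set Q := c 1
  set L := length c
  have hunit : ∀ ξ : H, ‖ξ‖ = 1 → (P ξ = ξ → ‖(1 - Q) ξ‖ ^ 2 ≤ Real.sin L ^ 2) ∧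
      (P ξ = 0 → ‖Q ξ‖ ^ 2 ≤ Real.sin L ^ 2) := by
    intro ξ hξ
    have h := hc.abs_arccos_sub_arccos_le hξ
    have hu := abs_le.1 (abs_reInner_symmetry_le_one hQ hξ)
    have hQ1 := norm_sq_eq_add_of_isStarProjection hQ ξ
    have hQ2 := reInner_symmetry hQ ξ
    have hP2 := reInner_symmetry hP ξ
    rw [hξ] at hQ1
    constructor
    · intro hPξ
      have h0 : (1 - P) ξ = 0 := by simp [hPξ]
      have e0 : reInner ξ (2 * P - 1) = 1 := by rw [hP2, h0, hPξ, hξ]; simp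
      rw [e0, Real.arccos_one, sub_zero, abs_of_nonneg (Real.arccos_nonneg _)] at h
      have := Real.cos_le_cos_of_nonneg_of_le_pi (Real.arccos_nonneg _) (by linarith) h
      rw [Real.cos_arccos hu.1 hu.2, hcos] at this
      linarith
    · intro hPξ
      have h0 : (1 - P) ξ = ξ := by simp [hPξ]
      have e0 : reInner ξ (2 * P - 1) = -1 := by rw [hP2, h0, hPξ, hξ]; simp
      rw [e0, Real.arccos_neg_one] at h
      have h' := (abs_le.1 h).1
      have := Real.cos_le_cos_of_nonneg_of_le_pi (x := Real.pi - 2 * L) (by linarith)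
        (Real.arccos_le_pi _) (by linarith)
      rw [Real.cos_arccos hu.1 hu.2, Real.cos_pi_sub, hcos] at this
      linarith
  have hscale : ∀ (X : H →L[ℂ] H) (p : H → Prop), (∀ (r : ℂ) ξ, p ξ → p (r • ξ)) →
      (∀ ξ, ‖ξ‖ = 1 → p ξ → ‖X ξ‖ ^ 2 ≤ Real.sin L ^ 2) →
      ∀ ξ, p ξ → ‖X ξ‖ ^ 2 ≤ Real.sin L ^ 2 * ‖ξ‖ ^ 2 := by
    intro X p hp h ξ hξ
    rcases eq_or_ne ξ 0 with rfl | hne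
    · simp
    have hn : (0 : ℝ) < ‖ξ‖ := norm_pos_iff.2 hne
    have h1 := h ((‖ξ‖⁻¹ : ℂ) • ξ) (norm_smul_inv_norm hne) (hp _ _ hξ)
    rw [map_smul, norm_smul, norm_inv, Complex.norm_real, norm_norm, mul_pow, inv_pow,
      inv_mul_le_iff₀ (by positivity)] at h1
    linarith
  refine ContinuousLinearMap.opNorm_le_bound _ hsin fun ξ => ?_
  have h1 := hscale (1 - Q) (fun ξ => P ξ = ξ) (fun r ξ h => by simp [h])
    (fun ξ hξ => (hunit ξ hξ).1) (P ξ) (congrArg (fun F : H →L[ℂ] H => F ξ) hP.1.eq)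
  have h2 := hscale Q (fun ξ => P ξ = 0) (fun r ξ h => by simp [h])
    (fun ξ hξ => (hunit ξ hξ).2) ((1 - P) ξ)
    (congrArg (fun F : H →L[ℂ] H => F ξ) hP.mul_one_sub_self)
  have h3 := norm_sq_eq_add_of_isStarProjection hP ξ
  have h4 := norm_sq_eq_add_of_isStarProjection hQ ((P - Q) ξ)
  have e1 : Q ((P - Q) ξ) = -(Q ((1 - P) ξ)) := by
    have : Q * (P - Q) = -(Q * (1 - P)) := by
      rw [mul_sub, mul_sub, hQ.1.eq, mul_one]; abel
    exact congrArg (fun F : H →L[ℂ] H => F ξ) this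
  have e2 : (1 - Q) ((P - Q) ξ) = (1 - Q) (P ξ) := by
    have : (1 - Q) * (P - Q) = (1 - Q) * P := by
      rw [mul_sub, hQ.one_sub_mul_self, sub_zero]
    exact congrArg (fun F : H →L[ℂ] H => F ξ) this
  rw [e1, e2, norm_neg] at h4
  refine le_of_sq_le_sq ?_ (by positivity)
  rw [h4, mul_pow, h3]
  linarith

end Vector

/-! ### Logarithms of unitaries. -/

section Logarithm

open NormedSpace selfAdjoint

variable {A : Type*} [CStarAlgebra A]

theorem exists_selfAdjoint_of_star_eq_neg {Y : A} (hY : star Y = -Y) :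
    ∃ a : selfAdjoint A, Complex.I • (a : A) = Y ∧ ‖a‖ = ‖Y‖ := by
  have h : IsSelfAdjoint (-(Complex.I • Y)) := by
    rw [IsSelfAdjoint, star_neg, star_smul, hY]
    simp
  refine ⟨⟨-(Complex.I • Y), h⟩, ?_, ?_⟩
  · rw [smul_neg, smul_smul, Complex.I_mul_I, neg_one_smul, neg_neg]
  · change ‖-(Complex.I • Y)‖ = ‖Y‖
    rw [norm_neg, norm_smul, Complex.norm_I, one_mul]

theorem eq_of_exp_eq {Y Z : A} (hY : star Y = -Y) (hZ : star Z = -Z) (hYn : ‖Y‖ < Real.pi)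
    (hZn : ‖Z‖ < Real.pi) (h : exp Y = exp Z) : Y = Z := by
  obtain ⟨a, rfl, ha⟩ := exists_selfAdjoint_of_star_eq_neg hY
  obtain ⟨b, rfl, hb⟩ := exists_selfAdjoint_of_star_eq_neg hZ
  have hab : expUnitary a = expUnitary b := Subtype.ext h
  have ha' : ‖a‖ < Real.pi := ha ▸ hYn
  have hb' : ‖b‖ < Real.pi := hb ▸ hZn
  rw [← argSelfAdjoint_expUnitary ha', ← argSelfAdjoint_expUnitary hb', hab]

/-- The operator form of the chord length `|exp(iθ) - 1| = 2 sin(θ/2)`. -/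
theorem norm_exp_sub_one {Y : A} (hY : star Y = -Y) (hYn : ‖Y‖ ≤ Real.pi) :
    ‖exp Y - 1‖ = 2 * Real.sin (‖Y‖ / 2) := by
  obtain ⟨a, rfl, ha⟩ := exists_selfAdjoint_of_star_eq_neg hY
  have h := norm_sq_expUnitary_sub_one (ha ▸ hYn)
  rw [expUnitary_coe, ha] at h
  have hs : 0 ≤ Real.sin (‖Complex.I • (a : A)‖ / 2) :=
    Real.sin_nonneg_of_nonneg_of_le_pi (by positivity) (by linarith [Real.pi_pos])
  have hc : Real.cos ‖Complex.I • (a : A)‖ = 1 - 2 * Real.sin (‖Complex.I • (a : A)‖ / 2) ^ 2 := by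
    rw [Real.sin_sq_eq_half_sub, mul_div_cancel₀ _ two_ne_zero]
    ring
  rw [hc] at h
  refine (pow_left_inj₀ (norm_nonneg _) (by positivity) two_ne_zero).1 ?_
  rw [h]
  ring

/-- The product of two symmetries at distance less than `√2` has a logarithm which anticommutes
with the second one. -/
theorem exists_log_mul_symmetry {V S : A} (hVs : star V = V) (hV : V * V = 1) (hSs : star S = S)
    (hS : S * S = 1) (h : ‖V * S - 1‖ ^ 2 < 2) :
    ∃ X : A, star X = -X ∧ X * S = -(S * X) ∧ ‖X‖ < Real.pi / 2 ∧ exp X = V * S := by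
  have hu : V * S ∈ unitary A := by
    rw [Unitary.mem_iff, star_mul, hVs, hSs]
    constructor
    · rw [mul_assoc, ← mul_assoc V V, hV, one_mul, hS]
    · rw [mul_assoc, ← mul_assoc S S, hS, one_mul, hV]
  set W : unitary A := ⟨V * S, hu⟩
  have hW : ‖(W - 1 : A)‖ < 2 := by
    change ‖V * S - 1‖ < 2
    nlinarith [norm_nonneg (V * S - 1)]
  have hexp := expUnitary_argSelfAdjoint hW
  have hnorm : ‖Unitary.argSelfAdjoint W‖ < Real.pi / 2 := by
    have h1 := Unitary.two_mul_one_sub_cos_norm_argSelfAdjoint hW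
    -- `2(1 - cos ‖a‖) = ‖VS - 1‖² < 2`.
    have h2 : 0 < Real.cos ‖Unitary.argSelfAdjoint W‖ := by
      change _ = ‖V * S - 1‖ ^ 2 at h1
      linarith
    by_contra! hle
    have := Real.cos_nonpos_of_pi_div_two_le_of_le hle
      ((Unitary.norm_argSelfAdjoint_le_pi W).trans (by linarith [Real.pi_pos]))
    linarith
  set a := Unitary.argSelfAdjoint W with ha
  set X : A := Complex.I • (a : A) with hX
  have hXs : star X = -X := by
    rw [hX, star_smul, a.2.star_eq]
    simp
  have hXn : ‖X‖ < Real.pi / 2 := by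
    rw [hX, norm_smul, Complex.norm_I, one_mul]
    exact hnorm
  have hXe : exp X = V * S := congrArg Subtype.val hexp
  refine ⟨X, hXs, ?_, hXn, hXe⟩
  have hSu : S ∈ unitary A := by rw [Unitary.mem_iff, hSs]; exact ⟨hS, hS⟩
  have hpi : Real.pi / 2 < Real.pi := by linarith [Real.pi_pos]
  -- `exp(-SXS) = S (VS)* S = VS`, so both sides are logarithms of `VS` with norm below `π`.
  have hconj : X = -(S * X * S) := by
    apply eq_of_exp_eq hXs _ (hXn.trans hpi)
    · rw [norm_neg, CStarRing.norm_mul_mem_unitary _ hSu, CStarRing.norm_mem_unitary_mul _ hSu]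
      exact hXn.trans hpi
    · let +nondep : NormedAlgebra ℚ A := .restrictScalars ℚ ℂ A
      have h1 := exp_units_conj (⟨S, S, hS, hS⟩ : Aˣ) (-X)
      simp only [Units.val_mk, Units.inv_mk] at h1
      have h2 : exp (-X) = S * V := by
        rw [← hXs, ← star_exp, hXe, star_mul, hVs, hSs]
      have h3 : -(S * X * S) = S * -X * S := by noncomm_ring
      rw [h3, h1, h2, hXe, ← mul_assoc, hS, one_mul]
    · rw [star_neg, star_mul, star_mul, hSs, hXs]
      noncomm_ring
  nth_rewrite 1 [hconj]
  rw [neg_mul, mul_assoc, hS, mul_one]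

end Logarithm

/-! ### Minimality, uniqueness and the midpoint. -/

section Main

open NormedSpace Set

variable {H : Type*} [NormedAddCommGroup H] [InnerProductSpace ℂ H] [CompleteSpace H]

theorem IsGeodesic.isPiecewiseSmoothCurve {γ : ℝ → H →L[ℂ] H} (h : IsGeodesic γ) :
    IsPiecewiseSmoothCurve γ where
  isProj := h.isProj
  pieces := by
    refine ⟨1, fun k => k, Nat.mono_cast, by simp, by simp, fun i hi => ?_⟩
    obtain rfl : i = 0 := by omega
    simpa using h.smooth

theorem symmetry_mul_self {P : H →L[ℂ] H} (hP : IsStarProjection P) :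
    (2 * P - 1) * (2 * P - 1) = 1 := by
  have : (2 * P - 1) * (2 * P - 1) = 4 * (P * P) - 4 * P + 1 := by noncomm_ring
  rw [this, hP.1.eq]
  noncomm_ring

theorem star_symmetry {P : H →L[ℂ] H} (hP : IsStarProjection P) :
    star (2 * P - 1) = 2 * P - 1 := by
  simp [two_mul, hP.2.star_eq]

theorem half_smul_one_add_symmetry {H : Type*} [NormedAddCommGroup H] [InnerProductSpace ℂ H]
    (P : H →L[ℂ] H) : (1 / 2 : ℝ) • (1 + (2 * P - 1)) = P := by
  rw [add_sub_cancel, two_mul, ← two_smul ℝ, smul_smul]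
  norm_num

theorem expCurve_zero (P Y : H →L[ℂ] H) : expCurve (2 * P - 1) Y 0 = P := by
  rw [expCurve, zero_smul, exp_zero, one_mul, half_smul_one_add_symmetry]

theorem expCurve_one_eq_iff {P Q Y : H →L[ℂ] H} (hP : IsStarProjection P) :
    expCurve (2 * P - 1) Y 1 = Q ↔ exp Y = (2 * Q - 1) * (2 * P - 1) := by
  have hS := symmetry_mul_self hP
  rw [expCurve, one_smul]
  constructor
  · rintro rfl
    rw [two_mul, ← two_smul ℝ, smul_smul]
    norm_num
    rw [mul_assoc, hS, mul_one]
  · intro h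
    rw [h, mul_assoc, hS, mul_one, half_smul_one_add_symmetry]

/-- If `Y` is shorter than `π`, the curve `expCurve S Y` is minimal among the curves of projections
with the same end points. -/
theorem isMinimalGeodesic_expCurve {P Q Y : H →L[ℂ] H} (hP : IsStarProjection P)
    (hYs : star Y = -Y) (hY : Y * (2 * P - 1) = -((2 * P - 1) * Y)) (hYn : ‖Y‖ ≤ Real.pi)
    (hQ : expCurve (2 * P - 1) Y 1 = Q) :
    IsMinimalGeodesic (expCurve (2 * P - 1) Y) P Q where
  geodesic := isGeodesic_expCurve (star_symmetry hP) (symmetry_mul_self hP) hYs hY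
  source := expCurve_zero P Y
  target := hQ
  minimal c hc hc0 hc1 := by
    rw [length_expCurve (star_symmetry hP) (symmetry_mul_self hP) hYs]
    -- A shorter curve has length below `π/2`, where the sine bound applies and `sin` is strictly
    -- increasing.
    by_contra! hlt
    have hL0 : 0 ≤ length c :=
      intervalIntegral.integral_nonneg zero_le_one fun t _ => norm_nonneg _
    have h1 := hc.norm_sub_le_sin (by linarith)
    have hSu : 2 * P - 1 ∈ unitary (H →L[ℂ] H) := by
      rw [Unitary.mem_iff, star_symmetry hP]
      exact ⟨symmetry_mul_self hP, symmetry_mul_self hP⟩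
    have h2 : ‖exp Y - 1‖ = 2 * ‖P - Q‖ := by
      rw [(expCurve_one_eq_iff hP).1 hQ, ← CStarRing.norm_mul_mem_unitary _ hSu, sub_mul,
        mul_assoc, symmetry_mul_self hP, one_mul, mul_one, norm_sub_rev]
      have : 2 * P - 1 - (2 * Q - 1) = (2 : ℝ) • (P - Q) := by
        rw [two_smul]; noncomm_ring
      rw [this, norm_smul]
      norm_num
    rw [norm_exp_sub_one hYs hYn] at h2
    rw [hc0, hc1] at h1
    have h3 := Real.sin_lt_sin_of_lt_of_le_pi_div_two (by linarith [Real.pi_pos])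
      (by linarith) hlt
    linarith

/-- If `Y` is shorter than `π`, the curve `expCurve S Y` is the only minimal geodesic with its end
points. -/
theorem IsMinimalGeodesic.eqOn_expCurve {P Q Y : H →L[ℂ] H} (hP : IsStarProjection P)
    (hYs : star Y = -Y) (hY : Y * (2 * P - 1) = -((2 * P - 1) * Y)) (hYn : ‖Y‖ < Real.pi)
    (hQ : expCurve (2 * P - 1) Y 1 = Q) {γ : ℝ → H →L[ℂ] H} (hγ : IsMinimalGeodesic γ P Q) :
    EqOn γ (expCurve (2 * P - 1) Y) (Icc 0 1) := by
  obtain ⟨Z, hZs, hZ, hZγ⟩ := hγ.geodesic.exists_eqOn_expCurve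
  rw [hγ.source] at hZ hZγ
  have hmin := isMinimalGeodesic_expCurve hP hYs hY hYn.le hQ
  have hle := hγ.minimal _ hmin.geodesic.isPiecewiseSmoothCurve hmin.source hmin.target
  rw [length_congr hZγ, length_expCurve (star_symmetry hP) (symmetry_mul_self hP) hYs,
    length_expCurve (star_symmetry hP) (symmetry_mul_self hP) hZs] at hle
  have hZ1 : expCurve (2 * P - 1) Z 1 = Q := by
    rw [← hZγ ⟨zero_le_one, le_rfl⟩, hγ.target]
  have hYZ : Z = Y := eq_of_exp_eq hZs hYs (by linarith) hYn
    (by rw [(expCurve_one_eq_iff hP).1 hZ1, (expCurve_one_eq_iff hP).1 hQ])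
  rwa [hYZ] at hZγ

/-- The projections onto the ranges of `E` and `E*` are joined by a short geodesic, with midpoint
the matched projection. -/
theorem exists_expCurve_matched {E : H →L[ℂ] H} (hE : IsIdempotentElem E) :
    ∃ Y : H →L[ℂ] H, star Y = -Y ∧
      Y * (2 * rangeProj E - 1) = -((2 * rangeProj E - 1) * Y) ∧ ‖Y‖ < Real.pi ∧
      expCurve (2 * rangeProj E - 1) Y 1 = rangeProj (ContinuousLinearMap.adjoint E) ∧
      matched E = expCurve (2 * rangeProj E - 1) Y (1 / 2) := by
  have h := isRangePair hE
  obtain ⟨J, h1, h2, hJ, hJ1⟩ := h.exists_inverse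
  obtain ⟨hVs, hV, hVSV, hlt⟩ := h.exists_symmetry h1 h2 hJ hJ1 rfl
  have hS := symmetry_mul_self h.left
  obtain ⟨X, hXs, hX, hXn, hXe⟩ :=
    exists_log_mul_symmetry hVs.star_eq hV (star_symmetry h.left) hS hlt
  -- Doubling reaches `Q`, since `exp(2X) = (VSV)S = (2Q - 1)S`, while half time gives `exp(X) S =
  -- V`.
  refine ⟨(2 : ℝ) • X, ?_, ?_, ?_, ?_, ?_⟩
  · rw [star_smul, hXs, smul_neg]
    rfl
  · rw [smul_mul_assoc, hX, mul_smul_comm, smul_neg]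
  · rw [norm_smul, Real.norm_ofNat]
    linarith
  · rw [expCurve_one_eq_iff h.left, two_smul]
    let +nondep : NormedAlgebra ℚ (H →L[ℂ] H) := .restrictScalars ℚ ℂ _
    rw [exp_add_of_commute (Commute.refl X), hXe, ← mul_assoc, hVSV]
  · rw [matched_eq hE h1 h2, expCurve, smul_smul, one_div_mul_cancel two_ne_zero, one_smul, hXe,
      mul_assoc, hS, mul_one]
    have hhalf : (1 / 2 : ℂ) = ((1 / 2 : ℝ) : ℂ) := by norm_num
    rw [hhalf]
    rfl

end Main

end MatchedProj

open MatchedProj in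
theorem mainTheorem1 {H : Type*} [NormedAddCommGroup H] [InnerProductSpace ℂ H] [CompleteSpace H]
    (E : H →L[ℂ] H) (hE : IsIdempotentElem E) :
    (∃ γ : ℝ → H →L[ℂ] H,
      IsMinimalGeodesic γ (rangeProj E) (rangeProj (ContinuousLinearMap.adjoint E))) ∧
    (∀ γ₁ γ₂ : ℝ → H →L[ℂ] H,
      IsMinimalGeodesic γ₁ (rangeProj E) (rangeProj (ContinuousLinearMap.adjoint E)) →
      IsMinimalGeodesic γ₂ (rangeProj E) (rangeProj (ContinuousLinearMap.adjoint E)) →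
      Set.EqOn γ₁ γ₂ (Set.Icc 0 1)) ∧
    (∀ γ : ℝ → H →L[ℂ] H,
      IsMinimalGeodesic γ (rangeProj E) (rangeProj (ContinuousLinearMap.adjoint E)) →
      matched E = γ (1 / 2)) := by 
  obtain ⟨Y, hYs, hY, hYn, hQ, hm⟩ := exists_expCurve_matched hE
  have hP := (isRangePair hE).left
  have huniq := fun γ => IsMinimalGeodesic.eqOn_expCurve (γ := γ) hP hYs hY hYn hQ
  refine ⟨⟨_, isMinimalGeodesic_expCurve hP hYs hY hYn.le hQ⟩,
    fun γ₁ γ₂ h₁ h₂ => (huniq γ₁ h₁).trans (huniq γ₂ h₂).symm, fun γ hγ => ?_⟩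
  rw [hm, huniq γ hγ ⟨by norm_num, by norm_num⟩]
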